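/- Consider the following bandit with $k+1$ arms and partially observed rewards. Each arm $a\in\{1,\dots,k\}$ has an unknown mean $\mu_a\in[0,1]$; the last arm $k+1$ has mean $\mu_{k+1}=0$, and pulling it terminates the interaction. At each time $t=1,2,\dots$ a policy chooses an arm $A_t$, possibly at random, given the history of the previously chosen arms and received signals. The pull produces a Bernoulli reward of mean $\mu_{A_t}$, drawn independently of the past; independently of everything else, the reward is revealed to the agent with probability $\rho$, and with probability $1-\rho$ the agent receives the symbol $\bot$ instead. Let $\mathbb P$ and $\mathbb E$ denote the probability measure and expectation induced by the policy and the bandit with means $\mu=[\mu_1,\dots,\mu_k,0]$, and let $T$ be the first time $t$ at which $A_t=k+1$. Only policies with $\mathbb P(T<\infty)=1$ for every $\mu\in[0,1]^k\times\{0\}$ are considered. Such a policy is called $(\epsilon,\delta)$-correct if for every $\mu\in[0,1]^k\times\{0\}$ $$\mathbb P\Big(\mu_{A_{T-1}}>\max_a\mu_a-\epsilon\Big)\ \ge\ 1-\delta ,$$ where the event is understood to fail if $T=1$ (no arm $A_{T-1}$ has been chosen). Then there exist constants $c_1,c_2>0$ such that for every $k\ge 2$, every $\epsilon\in(0,\tfrac18)$,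 every $\delta\in(0,\tfrac14e^{-4})$, every $\rho\in(0,1)$, and every $(\epsilon,\delta)$-correct policy, there exists a vector of means $[\mu_1,\dots,\mu_k,0]\in[0,1]^{k}\times\{0\}$ for which $$\mathbb E[T-1]\ \ge\ c_1\,\frac{k}{\rho\,\epsilon^2}\,\ln\frac{c_2}{\delta}.$$ -/

import Mathlib

open MeasureTheory ProbabilityTheory

namespace MonitoredBandit

/-- The `k + 1` arms. The arm `Fin.last k` terminates the interaction. -/
abbrev Arm (k : ℕ) : Type := Fin (k + 1)

/-- What the agent sees after a pull: `none` is the symbol `⊥` (the reward is not revealed),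
`some true` is a revealed reward `1` and `some false` is a revealed reward `0`. -/
abbrev Signal : Type := Option Bool

instance : MeasurableSpace Signal := ⊤

/-- One interaction step: the arm that was pulled and the signal that was received. -/
abbrev Step (k : ℕ) : Type := Arm k × Signal

/-- A (possibly randomized) policy: given the history of the `n` steps made so far, for every `n`,
it returns the distribution of the arm to be pulled next. -/
abbrev Policy (k : ℕ) : Type := (n : ℕ) → (Fin n → Step k) → PMF (Arm k)

/-- The means of all the arms: `μ₁, …, μ_k` and mean `0` for the terminating arm. -/
noncomputable def armMean {k : ℕ} (μ : Fin k → unitInterval) : Arm k → unitInterval :=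
  Fin.snoc (α := fun _ => unitInterval) μ 0

/-- The signal produced by `reveal`, the indicator that the reward is revealed, and `reward`. -/
def toSignal (reveal reward : Bool) : Signal := if reveal then some reward else none

/-- The law of the signal of an arm of mean `m`: a Bernoulli reward of mean `m`, revealed with
probability `ρ` independently of its value. -/
noncomputable def signalMeasure (ρ m : unitInterval) : Measure Signal :=
  ((bernoulliMeasure true false ρ).prod (bernoulliMeasure true false m)).map
    (fun p => toSignal p.1 p.2)

instance (ρ m : unitInterval) : IsProbabilityMeasure (signalMeasure ρ m) :=
  Measure.isProbabilityMeasure_map (Measurable.of_discrete).aemeasurable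

/-- The law of the received signal as a function of the pulled arm. -/
noncomputable def signalKernel {k : ℕ} (ρ : unitInterval) (μ : Fin k → unitInterval) :
    Kernel (Arm k) Signal :=
  Kernel.ofFunOfCountable (fun a => signalMeasure ρ (armMean μ a))

instance {k : ℕ} (ρ : unitInterval) (μ : Fin k → unitInterval) :
    IsMarkovKernel (signalKernel ρ μ) :=
  ⟨fun a => inferInstanceAs (IsProbabilityMeasure (signalMeasure ρ (armMean μ a)))⟩

/-- The law of a step whose arm is drawn from `p`. -/
noncomputable def stepMeasure {k : ℕ} (ρ : unitInterval) (μ : Fin k → unitInterval)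
    (p : PMF (Arm k)) : Measure (Step k) :=
  p.toMeasure ⊗ₘ signalKernel ρ μ

instance {k : ℕ} (ρ : unitInterval) (μ : Fin k → unitInterval) (p : PMF (Arm k)) :
    IsProbabilityMeasure (stepMeasure ρ μ p) := by
  unfold stepMeasure; infer_instance

/-- The first `n + 1` steps, indexed by `{0, …, n}`, as a history of length `n + 1`. -/
def toHistory {k : ℕ} (n : ℕ) (x : (_ : Finset.Iic n) → Step k) : Fin (n + 1) → Step k :=
  fun i => x ⟨i.1, Finset.mem_Iic.2 (Nat.lt_succ_iff.1 i.2)⟩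

/-- The conditional law of the next step given the first `n + 1` steps. -/
noncomputable def stepKernel {k : ℕ} (ρ : unitInterval) (μ : Fin k → unitInterval)
    (π : Policy k) (n : ℕ) : Kernel ((_ : Finset.Iic n) → Step k) (Step k) :=
  Kernel.ofFunOfCountable (fun x => stepMeasure ρ μ (π (n + 1) (toHistory n x)))

instance {k : ℕ} (ρ : unitInterval) (μ : Fin k → unitInterval) (π : Policy k) (n : ℕ) :
    IsMarkovKernel (stepKernel ρ μ π n) :=
  ⟨fun x => inferInstanceAs
    (IsProbabilityMeasure (stepMeasure ρ μ (π (n + 1) (toHistory n x))))⟩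

/-- The probability measure that the policy `π` and the bandit induce on the sequences of steps.
The entry `ω t` of a sequence is the step made at time `t + 1`. What happens after the terminating
arm has been pulled is irrelevant: every notion below looks only at the steps up to then. -/
noncomputable def banditMeasure {k : ℕ} (ρ : unitInterval) (μ : Fin k → unitInterval)
    (π : Policy k) : Measure (ℕ → Step k) :=
  Kernel.trajMeasure (X := fun _ => Step k) (stepMeasure ρ μ (π 0 Fin.elim0)) (stepKernel ρ μ π)

instance {k : ℕ} (ρ : unitInterval) (μ : Fin k → unitInterval) (π : Policy k) :
    IsProbabilityMeasure (banditMeasure ρ μ π) := by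
  unfold banditMeasure; infer_instance

/-- `T`: the first time, counted from `1`, at which the terminating arm is pulled
(`⊤` if this never happens). -/
noncomputable def stopTime {k : ℕ} (ω : ℕ → Step k) : ℕ∞ :=
  ⨅ (t : ℕ) (_ : (ω t).1 = Fin.last k), ((t + 1 : ℕ) : ℕ∞)

/-- The policy terminates with probability one, for every vector of means. -/
def Terminates {k : ℕ} (ρ : unitInterval) (π : Policy k) : Prop :=
  ∀ μ : Fin k → unitInterval, ∀ᵐ ω ∂(banditMeasure ρ μ π), stopTime ω < ⊤

/-- The event `μ_{A_{T-1}} > max_a μ_a - ε`. At `T = s + 2` the arm `A_{T-1}` is the arm of the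
step `ω s`. If `T = 1` no arm `A_{T-1}` was selected, and the event does not hold. -/
def correctEvent {k : ℕ} (μ : Fin k → unitInterval) (ε : ℝ) : Set (ℕ → Step k) :=
  {ω | ∃ s : ℕ, stopTime ω = ((s + 2 : ℕ) : ℕ∞) ∧
    (armMean μ (ω s).1 : ℝ) > (⨆ a : Arm k, (armMean μ a : ℝ)) - ε}

/-- `(ε, δ)`-correctness. -/
def IsCorrect {k : ℕ} (ρ : unitInterval) (ε δ : ℝ) (π : Policy k) : Prop :=
  ∀ μ : Fin k → unitInterval, (banditMeasure ρ μ π).real (correctEvent μ ε) ≥ 1 - δ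

/-- `E[T - 1]`, as a number in `[0, ∞]`. -/
noncomputable def expectedPulls {k : ℕ} (ρ : unitInterval) (μ : Fin k → unitInterval)
    (π : Policy k) : ENNReal :=
  ∫⁻ ω, ((stopTime ω - 1 : ℕ∞) : ENNReal) ∂(banditMeasure ρ μ π)

end MonitoredBandit

namespace MonitoredBandit

/-! Take the instance `uniformMeans`, with all means equal to 1/2. A correct policy must stop after
some pull with probability above 1/2, and stopping right after one arm means avoiding every other
one. Hence at most one arm `j` has probability below 1/4 that the interaction stops after an arm
different from `j` (`exists_half_le_add`, `half_le_card`).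

For each remaining arm `j`, raise its mean to 1/2 + ε. Stopping after another arm is now an error,
so the same event `E` has probability at most δ (`measureReal_stopsAfterOtherBy_le`). Only pulls of
`j` with a revealed reward distinguish the two instances, so one pull of `j` carries information at
most 4ρε² (`le_sum_signalMeasure_real_mul_log`). Write `L` for the stopped likelihood ratio and `N`
for the number of pulls of `j`. By Wald's identity, `E[log L] ≥ -4ρε² E[N]`. The inequality `log x ≤
x - 1`, applied to `e^l L` on `E` and to `L` off `E`, gives `l P(E) + E[log L] ≤ e^l P'(E)`. With `l
= log (1/δ)` this reads `log (1/δ) / 4 - 4ρε² E[N] ≤ 1`, which bounds `E[N]` from below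
(`le_integral_pullCount`).

Summing over at least k/2 arms bounds `E[T - 1]`. Everything is done at a finite horizon, where
histories form a finite set: integrals become finite sums and no integrability of `T` is needed. -/

/-- The first `n` steps of a sequence of steps. -/
def prefixOf {k : ℕ} (n : ℕ) (ω : ℕ → Step k) : Fin n → Step k := fun i => ω i

lemma measurable_prefixOf {k : ℕ} (n : ℕ) : Measurable (prefixOf (k := k) n) :=
  measurable_pi_lambda _ fun _ => measurable_pi_apply _

lemma measurableSet_prefixOf {k n : ℕ} (p : (Fin n → Step k) → Prop) :
    MeasurableSet {ω : ℕ → Step k | p (prefixOf n ω)} :=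
  measurable_prefixOf n (Set.Finite.measurableSet (Set.toFinite {h | p h}))

/-! ### Probabilities of signals and of single steps. -/

section Signal

variable (ρ m : unitInterval)

lemma signalMeasure_real_none : (signalMeasure ρ m).real {none} = 1 - ρ := by
  have : (fun p : Bool × Bool => toSignal p.1 p.2) ⁻¹' {none} = {false} ×ˢ Set.univ := by
    ext ⟨a, b⟩; cases a <;> simp [toSignal]
  rw [signalMeasure, map_measureReal_apply Measurable.of_discrete (by trivial), this,
    measureReal_prod_prod,
    bernoulliMeasure_real_apply_of_notMem_of_mem _ (.singleton _)
      (by rw [Set.mem_singleton_iff]; decide) (Set.mem_singleton _)]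
  simp

lemma signalMeasure_real_some_true : (signalMeasure ρ m).real {some true} = ρ * m := by
  have : (fun p : Bool × Bool => toSignal p.1 p.2) ⁻¹' {some true} = {true} ×ˢ {true} := by
    ext ⟨a, b⟩; cases a <;> simp [toSignal]
  rw [signalMeasure, map_measureReal_apply Measurable.of_discrete (by trivial), this,
    measureReal_prod_prod,
    bernoulliMeasure_real_apply_of_mem_of_notMem _ (.singleton _)
      (Set.mem_singleton _) (by rw [Set.mem_singleton_iff]; decide),
    bernoulliMeasure_real_apply_of_mem_of_notMem _ (.singleton _)
      (Set.mem_singleton _) (by rw [Set.mem_singleton_iff]; decide)]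

lemma signalMeasure_real_some_false : (signalMeasure ρ m).real {some false} = ρ * (1 - m) := by
  have : (fun p : Bool × Bool => toSignal p.1 p.2) ⁻¹' {some false} = {true} ×ˢ {false} := by
    ext ⟨a, b⟩; cases a <;> simp [toSignal]
  rw [signalMeasure, map_measureReal_apply Measurable.of_discrete (by trivial), this,
    measureReal_prod_prod,
    bernoulliMeasure_real_apply_of_mem_of_notMem _ (.singleton _)
      (Set.mem_singleton _) (by rw [Set.mem_singleton_iff]; decide),
    bernoulliMeasure_real_apply_of_notMem_of_mem _ (.singleton _)
      (by rw [Set.mem_singleton_iff]; decide) (Set.mem_singleton _)]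

end Signal

lemma stepMeasure_real_singleton {k : ℕ} (ρ : unitInterval) (μ : Fin k → unitInterval)
    (p : PMF (Arm k)) (x : Step k) :
    (stepMeasure ρ μ p).real {x}
      = (p x.1).toReal * (signalMeasure ρ (armMean μ x.1)).real {x.2} := by
  have hx : ({x} : Set (Step k)) = {x.1} ×ˢ {x.2} := by simp
  rw [measureReal_def, stepMeasure, hx, Measure.compProd_apply_prod (by simp) (by simp)]
  simp [signalKernel, Kernel.ofFunOfCountable, measureReal_def, mul_comm]

/-! ### The law of finite histories and change of measure. -/

section Law

variable {k : ℕ} (ρ : unitInterval) (μ : Fin k → unitInterval) (π : Policy k)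

/-- The probability of a history. -/
noncomputable def historyProb {n : ℕ} (h : Fin n → Step k) : ℝ :=
  (banditMeasure ρ μ π).real {ω | prefixOf n ω = h}

lemma map_eval_zero_banditMeasure :
    (banditMeasure ρ μ π).map (fun ω => ω 0) = stepMeasure ρ μ (π 0 Fin.elim0) := by
  have h1 : (fun ω : ℕ → Step k => ω 0)
      = MeasurableEquiv.piUnique (fun _ : Finset.Iic 0 => Step k) ∘
        Preorder.frestrictLe (π := fun _ => Step k) 0 := rfl
  rw [h1, ← Measure.map_map (by fun_prop) (by fun_prop), banditMeasure, Kernel.trajMeasure,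
    Measure.map_comp _ _ (by fun_prop), Kernel.traj_map_frestrictLe, Kernel.partialTraj_self,
    Measure.id_comp, Measure.map_map (by fun_prop) (by fun_prop)]
  exact (congrArg (Measure.map · _) (MeasurableEquiv.self_comp_symm _)).trans Measure.map_id

lemma banditMeasure_real_eval_zero (x : Step k) :
    (banditMeasure ρ μ π).real {ω | ω 0 = x} = (stepMeasure ρ μ (π 0 Fin.elim0)).real {x} := by
  rw [← map_eval_zero_banditMeasure, map_measureReal_apply (measurable_pi_apply 0) (by simp)]
  rfl

/-- Chain rule turning the abstract trajectory measure into explicit products. The first step is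
separate because it is drawn from the initial law rather than from `stepKernel`. -/
lemma historyProb_succ {n : ℕ} (h : Fin (n + 1) → Step k) :
    historyProb ρ μ π h = historyProb ρ μ π (Fin.init h) *
      (stepMeasure ρ μ (π n (Fin.init h))).real {h (Fin.last n)} := by
  cases n with
  | zero =>
    have h0 : Fin.init h = Fin.elim0 := Subsingleton.elim _ _
    have h1 : {ω : ℕ → Step k | prefixOf 0 ω = Fin.elim0} = Set.univ := by
      ext; simp [eq_iff_true_of_subsingleton]
    have h2 : {ω : ℕ → Step k | prefixOf 1 ω = h} = {ω | ω 0 = h (Fin.last 0)} := by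
      ext ω; simp [prefixOf, funext_iff, Fin.forall_fin_one]
    rw [h0, historyProb, historyProb, h1, h2, banditMeasure_real_eval_zero]
    simp
  | succ n =>
    set h' : (_ : Finset.Iic n) → Step k :=
      fun i => h ⟨i.1, by have := Finset.mem_Iic.1 i.2; omega⟩ with hh'
    have e1 : toHistory n h' = Fin.init h := by
      ext i : 1; rfl
    have e2 : {ω : ℕ → Step k | prefixOf (n + 1) ω = Fin.init h}
        = Preorder.frestrictLe (π := fun _ => Step k) n ⁻¹' {h'} := by
      ext ω
      simp only [Set.mem_ofPred_eq, Set.mem_preimage, Set.mem_singleton_iff, funext_iff,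
        Subtype.forall, Finset.mem_Iic, Preorder.frestrictLe_apply, hh', prefixOf, Fin.forall_iff,
        Nat.lt_succ_iff, Fin.init]
      rfl
    have e3 : {ω : ℕ → Step k | prefixOf (n + 2) ω = h}
        = (fun ω => (Preorder.frestrictLe (π := fun _ => Step k) n ω, ω (n + 1))) ⁻¹'
          ({h'} ×ˢ {h (Fin.last (n + 1))}) := by
      rw [Set.mk_preimage_prod, ← e2]
      ext ω
      simp only [Set.mem_ofPred_eq, Set.mem_inter_iff, Set.mem_preimage, Set.mem_singleton_iff,
        funext_iff, Fin.forall_fin_succ' (n := n + 1)]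
      rfl
    have key := Kernel.map_frestrictLe_trajMeasure_compProd_eq_map_trajMeasure
      (X := fun _ => Step k) (κ := stepKernel ρ μ π) (μ₀ := stepMeasure ρ μ (π 0 Fin.elim0))
      (a := n)
    have key' := congrArg (fun m => m.real ({h'} ×ˢ {h (Fin.last (n + 1))})) key
    rw [historyProb, historyProb, e3, banditMeasure,
      ← map_measureReal_apply (by fun_prop) (by measurability), ← key', measureReal_def,
      Measure.compProd_apply_prod (by measurability) (by measurability), lintegral_singleton,
      ENNReal.toReal_mul, mul_comm, e2, ← map_measureReal_apply (by fun_prop) (by measurability)]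
    simp only [stepKernel, Kernel.ofFunOfCountable, Kernel.coe_mk, e1]
    rfl

lemma integrable_comp_prefixOf {n : ℕ} (F : (Fin n → Step k) → ℝ) :
    Integrable (fun ω => F (prefixOf n ω)) (banditMeasure ρ μ π) := by
  have : IsProbabilityMeasure ((banditMeasure ρ μ π).map (prefixOf n)) :=
    Measure.isProbabilityMeasure_map (measurable_prefixOf n).aemeasurable
  exact (Integrable.of_finite (μ := (banditMeasure ρ μ π).map (prefixOf n))
    (f := F)).comp_measurable (measurable_prefixOf n)

lemma integral_comp_prefixOf {n : ℕ} (F : (Fin n → Step k) → ℝ) :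
    ∫ ω, F (prefixOf n ω) ∂banditMeasure ρ μ π = ∑ h, historyProb ρ μ π h * F h := by
  have : IsProbabilityMeasure ((banditMeasure ρ μ π).map (prefixOf n)) :=
    Measure.isProbabilityMeasure_map (measurable_prefixOf n).aemeasurable
  rw [← integral_map (measurable_prefixOf n).aemeasurable
      Measurable.of_discrete.aestronglyMeasurable,
    integral_fintype Integrable.of_finite]
  refine Finset.sum_congr rfl fun h _ => ?_
  rw [map_measureReal_apply (measurable_prefixOf n) (by simp)]
  rfl

variable {ρ μ π} in
/-- Change of measure along histories of a fixed length. -/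
lemma integral_comp_prefixOf_mul_prod {μ' : Fin k → unitInterval} {R : Step k → ℝ}
    (hR : ∀ p x, (stepMeasure ρ μ' p).real {x} = (stepMeasure ρ μ p).real {x} * R x)
    {n : ℕ} (F : (Fin n → Step k) → ℝ) :
    ∫ ω, F (prefixOf n ω) * ∏ i ∈ Finset.range n, R (ω i) ∂banditMeasure ρ μ π
      = ∫ ω, F (prefixOf n ω) ∂banditMeasure ρ μ' π := by
  have hw : ∀ (n : ℕ) (h : Fin n → Step k),
      historyProb ρ μ' π h = historyProb ρ μ π h * ∏ i, R (h i) := by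
    intro n
    induction n with
    | zero =>
      intro h
      have h1 : {ω : ℕ → Step k | prefixOf 0 ω = h} = Set.univ := by
        ext; simp [eq_iff_true_of_subsingleton]
      simp [historyProb, h1]
    | succ n ih =>
      intro h
      rw [historyProb_succ, historyProb_succ, ih, hR, Fin.prod_univ_castSucc]
      simp only [Fin.init]
      ring
  have h2 : ∀ ω : ℕ → Step k, F (prefixOf n ω) * ∏ i ∈ Finset.range n, R (ω i)
      = (fun h => F h * ∏ i, R (h i)) (prefixOf n ω) := by
    intro ω
    simp [prefixOf, Finset.prod_range]
  rw [integral_congr_ae (.of_forall h2),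
    integral_comp_prefixOf ρ μ π (fun h => F h * ∏ i, R (h i)), integral_comp_prefixOf]
  refine Finset.sum_congr rfl fun h _ => ?_
  rw [hw]; ring

/-- The signal of the arm pulled at time `n` is independent of what happened before. -/
lemma integral_prefixOf_arm_mul_signal {n : ℕ} (G : (Fin n → Step k) → Arm k → ℝ)
    (φ : Signal → ℝ) (a₀ : Arm k) (hG : ∀ h a, a ≠ a₀ → G h a = 0) :
    ∫ ω, G (prefixOf n ω) (ω n).1 * φ (ω n).2 ∂banditMeasure ρ μ π
      = (∑ s, (signalMeasure ρ (armMean μ a₀)).real {s} * φ s) *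
        ∫ ω, G (prefixOf n ω) (ω n).1 ∂banditMeasure ρ μ π := by
  have aux : ∀ ψ : Signal → ℝ,
      ∫ ω, G (prefixOf n ω) (ω n).1 * ψ (ω n).2 ∂banditMeasure ρ μ π
        = (∑ s, (signalMeasure ρ (armMean μ a₀)).real {s} * ψ s) *
          ∑ h, historyProb ρ μ π h * (π n h a₀).toReal * G h a₀ := by
    intro ψ
    have h1 : ∀ ω : ℕ → Step k, G (prefixOf n ω) (ω n).1 * ψ (ω n).2
      = (fun h : Fin (n + 1) → Step k => G (Fin.init h) (h (Fin.last n)).1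
          * ψ (h (Fin.last n)).2) (prefixOf (n + 1) ω) := fun ω => rfl
    rw [integral_congr_ae (.of_forall h1), integral_comp_prefixOf ρ μ π
      (fun h : Fin (n + 1) → Step k => G (Fin.init h) (h (Fin.last n)).1 * ψ (h (Fin.last n)).2),
      ← (Fin.snocEquiv (fun _ => Step k)).sum_comp,
      Fintype.sum_prod_type, Finset.sum_comm, Finset.mul_sum]
    refine Finset.sum_congr rfl fun h _ => ?_
    rw [Fintype.sum_prod_type, Finset.sum_eq_single a₀ _ (by simp), Finset.sum_mul]
    · refine Finset.sum_congr rfl fun s _ => ?_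
      rw [historyProb_succ, stepMeasure_real_singleton]
      simp [Fin.snocEquiv]
      ring
    · intro a _ ha
      refine Finset.sum_eq_zero fun s _ => ?_
      simp [Fin.snocEquiv, hG _ a ha]
  -- Taking the constant signal function 1 in `aux` identifies its second factor as the integral of
  -- `G` alone.
  have hone : ∑ s, (signalMeasure ρ (armMean μ a₀)).real {s} * (1 : ℝ) = 1 := by
    simp only [mul_one]
    rw [Fintype.sum_option, Fintype.sum_bool, signalMeasure_real_none,
      signalMeasure_real_some_true, signalMeasure_real_some_false]
    ring
  have := aux fun _ => 1
  rw [hone, one_mul] at this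
  simp only [mul_one] at this
  rw [aux φ, this]

end Law

/-! ### Functions of finitely many steps. -/

section DependsOn

variable {k : ℕ} {n : ℕ} {X : (ℕ → Step k) → ℝ}

lemma exists_eq_comp_prefixOf (hX : DependsOn X (Set.Iio n)) :
    ∃ F : (Fin n → Step k) → ℝ, X = fun ω => F (prefixOf n ω) := by
  -- The steps from `n` on are filled with an arbitrary value, which `X` ignores.
  refine ⟨fun h => X fun i => if hi : i < n then h ⟨i, hi⟩ else (0, none), funext fun ω => ?_⟩
  refine hX fun i hi => ?_
  simp only [dif_pos (Set.mem_Iio.1 hi), prefixOf]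

lemma integrable_of_dependsOn (ρ : unitInterval) (μ : Fin k → unitInterval) (π : Policy k)
    (hX : DependsOn X (Set.Iio n)) : Integrable X (banditMeasure ρ μ π) := by
  obtain ⟨F, rfl⟩ := exists_eq_comp_prefixOf hX
  exact integrable_comp_prefixOf ρ μ π F

lemma integral_mul_prod_of_dependsOn {ρ : unitInterval} {μ μ' : Fin k → unitInterval}
    (π : Policy k) {R : Step k → ℝ}
    (hR : ∀ p x, (stepMeasure ρ μ' p).real {x} = (stepMeasure ρ μ p).real {x} * R x)
    (hX : DependsOn X (Set.Iio n)) :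
    ∫ ω, X ω * ∏ i ∈ Finset.range n, R (ω i) ∂banditMeasure ρ μ π
      = ∫ ω, X ω ∂banditMeasure ρ μ' π := by
  obtain ⟨F, rfl⟩ := exists_eq_comp_prefixOf hX
  exact integral_comp_prefixOf_mul_prod hR F

lemma integral_arm_mul_signal_of_dependsOn (ρ : unitInterval) (μ : Fin k → unitInterval)
    (π : Policy k) (φ : Signal → ℝ) (a : Arm k) (hX : DependsOn X (Set.Iio n)) :
    ∫ ω, (if (ω n).1 = a then X ω else 0) * φ (ω n).2 ∂banditMeasure ρ μ π
      = (∑ s, (signalMeasure ρ (armMean μ a)).real {s} * φ s) *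
        ∫ ω, (if (ω n).1 = a then X ω else 0) ∂banditMeasure ρ μ π := by
  obtain ⟨F, rfl⟩ := exists_eq_comp_prefixOf hX
  exact integral_prefixOf_arm_mul_signal ρ μ π (fun h b => if b = a then F h else 0) φ a
    fun h b hb => if_neg hb

end DependsOn

/-! ### Stopping events, pull counts and stopped likelihood ratios. -/

/-- The terminating arm is not pulled in the first `n` steps. -/
def Running {k : ℕ} (n : ℕ) (ω : ℕ → Step k) : Prop := ∀ i < n, (ω i).1 ≠ Fin.last k

lemma Running.mono {k m n : ℕ} {ω : ℕ → Step k} (h : Running n ω) (hmn : m ≤ n) :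
    Running m ω := fun i hi => h i (hi.trans_le hmn)

lemma running_congr {k n : ℕ} {ω ω' : ℕ → Step k} (h : ∀ i < n, ω i = ω' i) :
    Running n ω ↔ Running n ω' :=
  forall₂_congr fun i hi => by rw [h i hi]

/-- The interaction stops at time `s + 2`, right after a pull of an arm different from `a`. -/
def StopsAfterOther {k : ℕ} (a : Arm k) (s : ℕ) (ω : ℕ → Step k) : Prop :=
  Running (s + 1) ω ∧ (ω (s + 1)).1 = Fin.last k ∧ (ω s).1 ≠ a

lemma stopsAfterOther_congr {k s : ℕ} {a : Arm k} {ω ω' : ℕ → Step k}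
    (h : ∀ i < s + 2, ω i = ω' i) : StopsAfterOther a s ω ↔ StopsAfterOther a s ω' := by
  rw [StopsAfterOther, StopsAfterOther, running_congr fun i hi => h i (by omega),
    h s (by omega), h (s + 1) (by omega)]

lemma StopsAfterOther.eq {k s s' : ℕ} {a b : Arm k} {ω : ℕ → Step k}
    (h : StopsAfterOther a s ω) (h' : StopsAfterOther b s' ω) : s = s' := by
  rcases lt_trichotomy s s' with hs | hs | hs
  · exact absurd h.2.1 (h'.1 _ (by omega))
  · exact hs
  · exact absurd h'.2.1 (h.1 _ (by omega))

open Classical in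
/-- The number of pulls of the arm `a` among the first `n` steps, before the interaction stops. -/
noncomputable def pullCount {k : ℕ} (a : Arm k) (n : ℕ) (ω : ℕ → Step k) : ℝ :=
  ∑ i ∈ Finset.range n, if (ω i).1 = a then (if Running i ω then 1 else 0) else 0

/-- The ratio of step probabilities when the signal probabilities of the arm `a` are multiplied
by `r`. -/
noncomputable def stepRatio {k : ℕ} (a : Arm k) (r : Signal → ℝ) (x : Step k) : ℝ :=
  if x.1 = a then r x.2 else 1

open Classical in
/-- The likelihood ratio of the first `n` steps, stopped when the interaction stops. -/
noncomputable def stoppedRatio {k : ℕ} (a : Arm k) (r : Signal → ℝ) (n : ℕ) (ω : ℕ → Step k) : ℝ :=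
  ∏ i ∈ Finset.range n, if Running i ω then stepRatio a r (ω i) else 1

lemma dependsOn_stoppedRatio {k : ℕ} (a : Arm k) (r : Signal → ℝ) (n : ℕ) :
    DependsOn (stoppedRatio a r n) (Set.Iio n) := by
  classical
  intro ω ω' h
  refine Finset.prod_congr rfl fun i hi => ?_
  have hi := Finset.mem_range.1 hi
  simp only [running_congr fun j (hj : j < i) => h j (Set.mem_Iio.2 (hj.trans hi)),
    h i (Set.mem_Iio.2 hi)]

lemma dependsOn_pullCount {k : ℕ} (a : Arm k) (n : ℕ) :
    DependsOn (pullCount a n) (Set.Iio n) := by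
  classical
  intro ω ω' h
  refine Finset.sum_congr rfl fun i hi => ?_
  have hi := Finset.mem_range.1 hi
  simp only [running_congr fun j (hj : j < i) => h j (Set.mem_Iio.2 (hj.trans hi)),
    h i (Set.mem_Iio.2 hi)]

lemma stoppedRatio_pos {k : ℕ} (a : Arm k) {r : Signal → ℝ} (hr : ∀ s, 0 < r s) (n : ℕ)
    (ω : ℕ → Step k) : 0 < stoppedRatio a r n ω := by
  refine Finset.prod_pos fun i _ => ?_
  unfold stepRatio
  split_ifs <;> simp [hr]

/-! ### Martingale property, Wald's identity and the information inequality. -/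

section Likelihood

variable {k : ℕ} {ρ : unitInterval} {μ μ' : Fin k → unitInterval} (π : Policy k)
  {a : Arm k} {r : Signal → ℝ}

-- The stopped likelihood ratio is a martingale started at 1: its increment is a function of the
-- past and the current arm, times `r - 1`, which has mean zero under the signal law of `a`.
open Classical in
lemma integral_stoppedRatio (hr : ∑ s, (signalMeasure ρ (armMean μ a)).real {s} * r s = 1)
    (hone : ∑ s, (signalMeasure ρ (armMean μ a)).real {s} = 1) (n : ℕ) :
    ∫ ω, stoppedRatio a r n ω ∂banditMeasure ρ μ π = 1 := by
  induction n with
  | zero => simp [stoppedRatio]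
  | succ n ih =>
    set X : (ℕ → Step k) → ℝ := fun ω => if Running n ω then stoppedRatio a r n ω else 0 with hX
    have hdep : DependsOn X (Set.Iio n) := by
      intro ω ω' h
      simp only [hX, dependsOn_stoppedRatio a r n h,
        running_congr fun j (hj : j < n) => h j (Set.mem_Iio.2 hj)]
    have h1 : ∀ ω, stoppedRatio a r (n + 1) ω
        = stoppedRatio a r n ω + (if (ω n).1 = a then X ω else 0) * (r (ω n).2 - 1) := by
      intro ω
      rw [stoppedRatio, Finset.prod_range_succ, ← stoppedRatio, hX]
      simp only [stepRatio]
      split_ifs <;> ring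
    have hd : DependsOn (fun ω => (if (ω n).1 = a then X ω else 0) * (r (ω n).2 - 1))
        (Set.Iio (n + 1)) := by
      intro ω ω' h
      simp only [h n (Set.mem_Iio.2 n.lt_succ_self),
        hdep fun i hi => h i (Set.Iio_subset_Iio n.le_succ hi)]
    rw [integral_congr_ae (.of_forall h1), integral_add
      (integrable_of_dependsOn ρ μ π (dependsOn_stoppedRatio a r n))
      (integrable_of_dependsOn ρ μ π hd), ih,
      integral_arm_mul_signal_of_dependsOn ρ μ π (fun s => r s - 1) a hdep]
    simp only [mul_sub, mul_one, Finset.sum_sub_distrib, hr, hone]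
    ring

open Classical in
/-- Wald's identity for the log-likelihood ratio. -/
lemma integral_log_stoppedRatio (hr : ∀ s, 0 < r s) (n : ℕ) :
    ∫ ω, Real.log (stoppedRatio a r n ω) ∂banditMeasure ρ μ π
      = (∑ s, (signalMeasure ρ (armMean μ a)).real {s} * Real.log (r s)) *
        ∫ ω, pullCount a n ω ∂banditMeasure ρ μ π := by
  have hdep : ∀ i, DependsOn (fun ω : ℕ → Step k => if Running i ω then (1 : ℝ) else 0)
      (Set.Iio i) := by
    intro i ω ω' h
    simp only [running_congr fun j (hj : j < i) => h j (Set.mem_Iio.2 hj)]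
  have h1 : ∀ ω : ℕ → Step k, Real.log (stoppedRatio a r n ω) = ∑ i ∈ Finset.range n,
      (if (ω i).1 = a then (if Running i ω then 1 else 0) else 0) * Real.log (r (ω i).2) := by
    intro ω
    rw [stoppedRatio, Real.log_prod]
    · refine Finset.sum_congr rfl fun i _ => ?_
      simp only [stepRatio]
      split_ifs <;> simp
    · intro i _
      simp only [stepRatio]
      split_ifs <;> simp [(hr _).ne']
  rw [integral_congr_ae (.of_forall h1), integral_finsetSum]
  · unfold pullCount
    rw [integral_finsetSum, Finset.mul_sum]
    · exact Finset.sum_congr rfl fun i _ =>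
        integral_arm_mul_signal_of_dependsOn ρ μ π (fun s => Real.log (r s)) a (hdep i)
    · intro i _
      refine integrable_of_dependsOn (n := i + 1) ρ μ π fun ω ω' h => ?_
      simp only [h i (Set.mem_Iio.2 i.lt_succ_self),
        running_congr fun j (hj : j < i) => h j (Set.mem_Iio.2 (by omega))]
  · intro i _
    refine integrable_of_dependsOn (n := i + 1) ρ μ π fun ω ω' h => ?_
    simp only [h i (Set.mem_Iio.2 i.lt_succ_self),
      running_congr fun j (hj : j < i) => h j (Set.mem_Iio.2 (by omega))]

/-- The interaction stops, at time at most `n + 1`, after a pull of an arm different from `a`. -/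
def stopsAfterOtherBy (a : Arm k) (n : ℕ) : Set (ℕ → Step k) :=
  {ω | ∃ s < n, StopsAfterOther a s ω}

lemma dependsOn_indicator_stopsAfterOtherBy (a : Arm k) (n : ℕ) :
    DependsOn ((stopsAfterOtherBy a n).indicator (1 : (ℕ → Step k) → ℝ)) (Set.Iio (n + 1)) := by
  classical
  intro ω ω' h
  have : ω ∈ stopsAfterOtherBy a n ↔ ω' ∈ stopsAfterOtherBy a n :=
    exists_congr fun s => and_congr_right fun hs =>
      stopsAfterOther_congr fun i hi => h i (Set.mem_Iio.2 (by omega))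
  simp only [Set.indicator_apply, this, Pi.one_apply]

lemma measurableSet_stopsAfterOtherBy (a : Arm k) (n : ℕ) :
    MeasurableSet (stopsAfterOtherBy a n) := by
  obtain ⟨F, hF⟩ := exists_eq_comp_prefixOf (dependsOn_indicator_stopsAfterOtherBy a n)
  have : stopsAfterOtherBy a n = {ω | F (prefixOf (n + 1) ω) = 1} := by
    ext ω
    rw [Set.mem_ofPred_eq, ← congrFun hF ω]
    by_cases h : ω ∈ stopsAfterOtherBy a n <;> simp [h]
  rw [this]
  exact measurableSet_prefixOf (n := n + 1) fun h => F h = 1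

-- The event splits disjointly according to the stopping time. On the piece for `s`, the stopped
-- ratio is frozen after the first `s + 2` steps and equals the full likelihood ratio of those
-- steps, so the fixed-length change of measure applies to each piece.
open Classical in
lemma integral_stoppedRatio_mul_indicator
    (hR : ∀ p x, (stepMeasure ρ μ' p).real {x} = (stepMeasure ρ μ p).real {x} * stepRatio a r x)
    (n : ℕ) :
    ∫ ω, stoppedRatio a r (n + 1) ω * (stopsAfterOtherBy a n).indicator 1 ω ∂banditMeasure ρ μ π
      = (banditMeasure ρ μ' π).real (stopsAfterOtherBy a n) := by
  have hdep : ∀ s, DependsOn (fun ω : ℕ → Step k => if StopsAfterOther a s ω then (1 : ℝ) else 0)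
      (Set.Iio (s + 2)) := by
    intro s ω ω' h
    simp only [stopsAfterOther_congr fun j (hj : j < s + 2) => h j (Set.mem_Iio.2 hj)]
  have hind : ∀ ω : ℕ → Step k, (stopsAfterOtherBy a n).indicator (1 : (ℕ → Step k) → ℝ) ω
      = ∑ s ∈ Finset.range n, if StopsAfterOther a s ω then (1 : ℝ) else 0 := by
    intro ω
    by_cases h : ω ∈ stopsAfterOtherBy a n
    · obtain ⟨s, hs, h'⟩ := id h
      rw [Finset.sum_eq_single s (fun t _ ht => if_neg fun h'' => ht (h''.eq h'))
        (fun h'' => absurd (Finset.mem_range.2 hs) h''), if_pos h']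
      simp [h]
    · rw [Finset.sum_eq_zero fun s hs => if_neg fun h' => h ⟨s, Finset.mem_range.1 hs, h'⟩]
      simp [h]
  have hratio : ∀ s ∈ Finset.range n, ∀ ω : ℕ → Step k, StopsAfterOther a s ω →
      stoppedRatio a r (n + 1) ω = ∏ i ∈ Finset.range (s + 2), stepRatio a r (ω i) := by
    intro s hs ω h
    have hs := Finset.mem_range.1 hs
    -- The terminating step, of index `s + 1`, still contributes its factor; every later factor is
    -- 1.
    rw [stoppedRatio, ← Finset.prod_subset (s₁ := Finset.range (s + 2))
      (Finset.range_subset_range.2 (by omega))]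
    · refine Finset.prod_congr rfl fun i hi => if_pos (h.1.mono ?_)
      have := Finset.mem_range.1 hi
      omega
    · intro i _ hi
      refine if_neg fun h' => h' (s + 1) ?_ h.2.1
      rw [Finset.mem_range] at hi
      omega
  have h1 : ∀ ω : ℕ → Step k, stoppedRatio a r (n + 1) ω * (stopsAfterOtherBy a n).indicator 1 ω
      = ∑ s ∈ Finset.range n, (if StopsAfterOther a s ω then (1 : ℝ) else 0) *
          ∏ i ∈ Finset.range (s + 2), stepRatio a r (ω i) := by
    intro ω
    rw [hind, Finset.mul_sum]
    refine Finset.sum_congr rfl fun s hs => ?_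
    by_cases h : StopsAfterOther a s ω
    · rw [hratio s hs ω h, mul_comm]
    · simp [h]
  rw [integral_congr_ae (.of_forall h1), integral_finsetSum,
    ← integral_indicator_one (measurableSet_stopsAfterOtherBy a n),
    integral_congr_ae (.of_forall hind), integral_finsetSum]
  · exact Finset.sum_congr rfl fun s _ => integral_mul_prod_of_dependsOn π hR (hdep s)
  · exact fun s _ => integrable_of_dependsOn ρ μ' π (hdep s)
  · intro s _
    refine integrable_of_dependsOn (n := s + 2) ρ μ π fun ω ω' h => ?_
    simp only [stopsAfterOther_congr fun j (hj : j < s + 2) => h j (Set.mem_Iio.2 hj)]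
    congr 1
    exact Finset.prod_congr rfl fun i hi => by rw [h i (Set.mem_Iio.2 (Finset.mem_range.1 hi))]

/-- A variational form of the data processing inequality: an event that is likely under `μ` and
unlikely under `μ'` forces many pulls of the arm on which the two instances differ. -/
lemma mul_measureReal_stopsAfterOtherBy_le (hr : ∀ s, 0 < r s)
    (hR : ∀ p x, (stepMeasure ρ μ' p).real {x} = (stepMeasure ρ μ p).real {x} * stepRatio a r x)
    (hsum : ∑ s, (signalMeasure ρ (armMean μ a)).real {s} * r s = 1)
    (hone : ∑ s, (signalMeasure ρ (armMean μ a)).real {s} = 1) (l : ℝ) (n : ℕ) :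
    l * (banditMeasure ρ μ π).real (stopsAfterOtherBy a n)
      + (∑ s, (signalMeasure ρ (armMean μ a)).real {s} * Real.log (r s)) *
          ∫ ω, pullCount a (n + 1) ω ∂banditMeasure ρ μ π
      ≤ Real.exp l * (banditMeasure ρ μ' π).real (stopsAfterOtherBy a n) := by
  -- This is `log x ≤ x - 1` with `x = e^l L` on the event and `x = L` off it; the extra `L` on the
  -- event is nonnegative, and its integral over the whole space is 1.
  have hpt : ∀ ω : ℕ → Step k,
      l * (stopsAfterOtherBy a n).indicator (1 : (ℕ → Step k) → ℝ) ω
        + Real.log (stoppedRatio a r (n + 1) ω)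
      ≤ stoppedRatio a r (n + 1) ω + Real.exp l *
        (stoppedRatio a r (n + 1) ω * (stopsAfterOtherBy a n).indicator 1 ω) - 1 := by
    intro ω
    have hpos := stoppedRatio_pos a hr (n + 1) ω
    by_cases h : ω ∈ stopsAfterOtherBy a n
    · have h1 := Real.log_le_sub_one_of_pos (mul_pos (Real.exp_pos l) hpos)
      rw [Real.log_mul (Real.exp_pos l).ne' hpos.ne', Real.log_exp] at h1
      simp only [h, Set.indicator_of_mem, Pi.one_apply, mul_one]
      linarith
    · have h1 := Real.log_le_sub_one_of_pos hpos
      simp only [h, not_false_eq_true, Set.indicator_of_notMem, mul_zero]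
      linarith
  have hi := integrable_of_dependsOn ρ μ π (dependsOn_indicator_stopsAfterOtherBy a n)
  have hM := integrable_of_dependsOn ρ μ π (dependsOn_stoppedRatio a r (n + 1))
  have hlog : Integrable (fun ω => Real.log (stoppedRatio a r (n + 1) ω))
      (banditMeasure ρ μ π) :=
    integrable_of_dependsOn (n := n + 1) ρ μ π fun ω ω' h => by
      simp only [dependsOn_stoppedRatio a r (n + 1) h]
  have hMi : Integrable (fun ω => stoppedRatio a r (n + 1) ω *
      (stopsAfterOtherBy a n).indicator 1 ω) (banditMeasure ρ μ π) :=
    integrable_of_dependsOn (n := n + 1) ρ μ π fun ω ω' h => by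
      simp only [dependsOn_stoppedRatio a r (n + 1) h, dependsOn_indicator_stopsAfterOtherBy a n h]
  have hMM : Integrable (fun ω => stoppedRatio a r (n + 1) ω + Real.exp l *
      (stoppedRatio a r (n + 1) ω * (stopsAfterOtherBy a n).indicator 1 ω))
      (banditMeasure ρ μ π) := hM.add (hMi.const_mul (Real.exp l))
  have := integral_mono ((hi.const_mul l).add hlog) (hMM.sub (integrable_const 1)) hpt
  simp only [Pi.add_apply, Pi.sub_apply] at this
  rw [integral_add (hi.const_mul l) hlog, integral_sub hMM (integrable_const 1),
    integral_add hM (hMi.const_mul _), integral_const_mul,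
    integral_const_mul, integral_stoppedRatio π hsum hone,
    integral_stoppedRatio_mul_indicator π hR, integral_log_stoppedRatio π hr,
    integral_indicator_one (measurableSet_stopsAfterOtherBy a n)] at this
  simp only [integral_const, probReal_univ, smul_eq_mul] at this
  linarith

end Likelihood

/-! ### Comparison of pull counts with the stopping time. -/

lemma stopTime_eq_iff {k : ℕ} {ω : ℕ → Step k} {m : ℕ} :
    stopTime ω = ((m + 1 : ℕ) : ℕ∞) ↔ Running m ω ∧ (ω m).1 = Fin.last k := by
  constructor
  · intro h
    have hrun : Running m ω := by
      intro i hi hlast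
      have h1 : stopTime ω ≤ ((i + 1 : ℕ) : ℕ∞) := iInf₂_le i hlast
      rw [h, Nat.cast_le] at h1
      omega
    refine ⟨hrun, by_contra fun hne => ?_⟩
    have h1 : ((m + 2 : ℕ) : ℕ∞) ≤ stopTime ω := by
      refine le_iInf₂ fun t ht => Nat.cast_le.2 ?_
      by_contra hlt
      rcases (show t < m ∨ t = m by omega) with h' | rfl
      · exact hrun t h' ht
      · exact hne ht
    rw [h, Nat.cast_le] at h1
    omega
  · rintro ⟨hrun, hlast⟩
    refine le_antisymm (iInf₂_le m hlast) (le_iInf₂ fun t ht => Nat.cast_le.2 ?_)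
    by_contra hlt
    exact hrun t (by omega) ht

/-- Summing over the arms, the pulls made before the interaction stops number at most `T - 1`. -/
lemma ofReal_sum_pullCount_le {k : ℕ} (J : Finset (Fin k)) (n : ℕ) (ω : ℕ → Step k) :
    ENNReal.ofReal (∑ j ∈ J, pullCount j.castSucc n ω) ≤ ((stopTime ω - 1 : ℕ∞) : ENNReal) := by
  classical
  by_cases hterm : ∃ m, (ω m).1 = Fin.last k
  · set m := Nat.find hterm
    have hm : (ω m).1 = Fin.last k := Nat.find_spec hterm
    have hrun : Running m ω := fun i hi => Nat.find_min hterm hi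
    rw [stopTime_eq_iff.2 ⟨hrun, hm⟩]
    have hle : ∑ j ∈ J, pullCount j.castSucc n ω ≤ m := by
      unfold pullCount
      rw [Finset.sum_comm]
      -- A step before the stop is a pull of at most one arm of `J`. The terminating step is a pull
      -- of none, and later steps are not counted.
      calc _ ≤ ∑ i ∈ Finset.range n, if i < m then (1 : ℝ) else 0 := by
            refine Finset.sum_le_sum fun i _ => ?_
            by_cases hi : i < m
            · rw [if_pos hi]
              by_cases hj : ∃ j ∈ J, (ω i).1 = j.castSucc
              · obtain ⟨j, hjJ, hj⟩ := hj
                rw [Finset.sum_eq_single j]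
                · split_ifs <;> simp
                · intro b _ hb
                  rw [hj, if_neg fun h => hb (Fin.castSucc_injective k h).symm]
                · exact fun h => absurd hjJ h
              · push Not at hj
                rw [Finset.sum_eq_zero fun j hjJ => if_neg (hj j hjJ)]
                exact zero_le_one
            · rw [if_neg hi]
              refine (Finset.sum_eq_zero fun j _ => ?_).le
              split_ifs with h1 h2
              · rcases (not_lt.1 hi).eq_or_lt with h3 | h3
                · rw [← h3, hm] at h1
                  exact absurd h1.symm (Fin.castSucc_lt_last j).ne
                · exact absurd hm (h2 m h3)
              · rfl
              · rfl
        _ ≤ m := by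
            rw [← Finset.sum_filter, Finset.sum_const, nsmul_eq_mul, mul_one, Nat.cast_le]
            calc _ ≤ (Finset.range m).card := Finset.card_le_card fun i hi =>
                  Finset.mem_range.2 (Finset.mem_filter.1 hi).2
              _ = m := Finset.card_range m
    have : (((m + 1 : ℕ) : ℕ∞) - 1) = (m : ℕ∞) := (ENat.natCast_sub (m + 1) 1).symm
    rw [this]
    calc ENNReal.ofReal (∑ j ∈ J, pullCount j.castSucc n ω) ≤ ENNReal.ofReal m :=
          ENNReal.ofReal_le_ofReal hle
      _ = _ := by simp
  · have : stopTime ω = ⊤ := by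
      push Not at hterm
      simp [stopTime, hterm]
    rw [this]
    exact le_top

lemma ofReal_sum_integral_pullCount_le {k : ℕ} (ρ : unitInterval) (μ : Fin k → unitInterval)
    (π : Policy k) (J : Finset (Fin k)) (n : ℕ) :
    ENNReal.ofReal (∑ j ∈ J, ∫ ω, pullCount j.castSucc n ω ∂banditMeasure ρ μ π)
      ≤ expectedPulls ρ μ π := by
  have hi : ∀ j ∈ J, Integrable (pullCount j.castSucc n) (banditMeasure ρ μ π) :=
    fun j _ => integrable_of_dependsOn ρ μ π (dependsOn_pullCount j.castSucc n)
  rw [← integral_finsetSum _ hi, ofReal_integral_eq_lintegral_ofReal (integrable_finsetSum _ hi)]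
  · exact lintegral_mono fun ω => ofReal_sum_pullCount_le J n ω
  · refine .of_forall fun ω => Finset.sum_nonneg fun j _ => Finset.sum_nonneg fun i _ => ?_
    split_ifs <;> simp

/-! ### The hard instances and the information carried by one pull. -/

/-- The instance all of whose arms have mean `1 / 2`. -/
noncomputable def uniformMeans (k : ℕ) : Fin k → unitInterval :=
  fun _ => ⟨1 / 2, by norm_num, by norm_num⟩

lemma armMean_castSucc {k : ℕ} (μ : Fin k → unitInterval) (j : Fin k) :
    armMean μ j.castSucc = μ j :=
  Fin.snoc_castSucc (α := fun _ => unitInterval) _ _ _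

lemma armMean_last {k : ℕ} (μ : Fin k → unitInterval) : armMean μ (Fin.last k) = 0 :=
  Fin.snoc_last (α := fun _ => unitInterval) _ _

lemma armMean_update_of_ne {k : ℕ} (μ : Fin k → unitInterval) (j : Fin k) (m : unitInterval)
    {a : Arm k} (ha : a ≠ j.castSucc) : armMean (Function.update μ j m) a = armMean μ a := by
  induction a using Fin.lastCases with
  | last => rw [armMean_last, armMean_last]
  | cast i =>
    rw [armMean_castSucc, armMean_castSucc, Function.update_of_ne]
    rintro rfl
    exact ha rfl

/-- The ratio between the signal probabilities of arms of means `1 / 2 + ε` and `1 / 2`. -/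
noncomputable def signalRatio (ε : ℝ) : Signal → ℝ
  | none => 1
  | some true => 1 + 2 * ε
  | some false => 1 - 2 * ε

lemma sum_signalMeasure_real_mul (ρ m : unitInterval) (φ : Signal → ℝ) :
    ∑ s, (signalMeasure ρ m).real {s} * φ s
      = (1 - ρ) * φ none + (ρ * m * φ (some true) + ρ * (1 - m) * φ (some false)) := by
  rw [Fintype.sum_option, Fintype.sum_bool, signalMeasure_real_none,
    signalMeasure_real_some_true, signalMeasure_real_some_false]

lemma signalMeasure_real_eq_mul_signalRatio (ρ : unitInterval) {m₀ m : unitInterval} {ε : ℝ}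
    (hm₀ : (m₀ : ℝ) = 1 / 2) (hm : (m : ℝ) = 1 / 2 + ε) (s : Signal) :
    (signalMeasure ρ m).real {s} = (signalMeasure ρ m₀).real {s} * signalRatio ε s := by
  rcases s with _ | _ | _
  · simp only [signalMeasure_real_none, signalRatio, mul_one]
  · simp only [signalMeasure_real_some_false, signalRatio, hm₀, hm]; ring
  · simp only [signalMeasure_real_some_true, signalRatio, hm₀, hm]; ring

/-- The sum is minus the relative entropy of the two signal laws. The unrevealed signal contributes
nothing, so it equals `(ρ / 2) log (1 - 4ε²)`. The bound follows from `log x ≥ 1 - 1/x` and `1 / (1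
- 4ε²) ≤ 1 + 8ε²`, the latter valid for `ε² ≤ 1/8`. -/
lemma le_sum_signalMeasure_real_mul_log (ρ : unitInterval) {m₀ : unitInterval} {ε : ℝ}
    (hε : 0 < ε) (hε' : ε < 1 / 8) (hm₀ : (m₀ : ℝ) = 1 / 2) :
    -(4 * ρ * ε ^ 2) ≤ ∑ s, (signalMeasure ρ m₀).real {s} * Real.log (signalRatio ε s) := by
  have hpos : (0 : ℝ) < (1 + 2 * ε) * (1 - 2 * ε) := mul_pos (by linarith) (by linarith)
  have hlog := Real.one_sub_inv_le_log_of_pos hpos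
  rw [Real.log_mul (by linarith) (by linarith)] at hlog
  have hinv : ((1 + 2 * ε) * (1 - 2 * ε))⁻¹ ≤ 1 + 8 * ε ^ 2 := by
    rw [inv_le_iff_one_le_mul₀ hpos]
    nlinarith [mul_nonneg (sq_nonneg ε) (by nlinarith : (0 : ℝ) ≤ 1 - 8 * ε ^ 2)]
  rw [sum_signalMeasure_real_mul]
  simp only [signalRatio, Real.log_one, hm₀]
  nlinarith [ρ.2.1]

/-! ### Consequences of correctness and the lower bound for one arm. -/

section LowerBound

variable {k : ℕ} {ε δ : ℝ} {ρ : unitInterval} {π : Policy k}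

/-- Under the instance in which the arm `j` is better than the others by `ε`, a correct policy
seldom stops after another arm. -/
lemma measureReal_stopsAfterOtherBy_le (hπ : IsCorrect ρ ε δ π) (j : Fin k)
    {m : unitInterval} (hm : (m : ℝ) = 1 / 2 + ε) (n : ℕ) :
    (banditMeasure ρ (Function.update (uniformMeans k) j m) π).real
      (stopsAfterOtherBy j.castSucc n) ≤ δ := by
  set μ' := Function.update (uniformMeans k) j m with hμ'
  -- The other arms fall short of the best mean by at least ε, and the strict inequality in
  -- `correctEvent` rules them out even when the gap is exactly ε.
  have hdisj : Disjoint (correctEvent μ' ε) (stopsAfterOtherBy j.castSucc n) := by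
    rw [Set.disjoint_left]
    rintro ω ⟨s, hs, hmean⟩ ⟨t, -, hrun, hlast, hne⟩
    have ht : stopTime ω = ((t + 2 : ℕ) : ℕ∞) := stopTime_eq_iff.2 ⟨hrun, hlast⟩
    obtain rfl : s = t := by
      have := Nat.cast_injective (R := ℕ∞) (hs.symm.trans ht)
      omega
    have hsup : (1 / 2 + ε : ℝ) ≤ ⨆ a : Arm k, (armMean μ' a : ℝ) := by
      have := le_ciSup (f := fun a : Arm k => (armMean μ' a : ℝ))
        (Set.finite_range _).bddAbove j.castSucc
      simpa only [armMean_castSucc, hμ', Function.update_self, hm] using this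
    have hle : (armMean μ' (ω s).1 : ℝ) ≤ 1 / 2 := by
      rw [hμ', armMean_update_of_ne _ _ _ hne]
      induction (ω s).1 using Fin.lastCases with
      | last => rw [armMean_last]; norm_num
      | cast i => rw [armMean_castSucc, uniformMeans]
    linarith
  have h1 := measureReal_union (μ := banditMeasure ρ μ' π) hdisj
    (measurableSet_stopsAfterOtherBy j.castSucc n)
  have h2 : (banditMeasure ρ μ' π).real
      (correctEvent μ' ε ∪ stopsAfterOtherBy j.castSucc n) ≤ 1 := measureReal_le_one
  have h3 := hπ μ'
  linarith

/-- For all large `n` a correct policy stops after one of its first `n` pulls with probability at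
least `1 / 2`, so any two arms cannot both be unlikely to be avoided. -/
lemma exists_half_le_add (hδ : δ < 1 / 2) (hπ : IsCorrect ρ ε δ π) (μ : Fin k → unitInterval) :
    ∃ n, ∀ a b : Arm k, a ≠ b → 1 / 2 ≤ (banditMeasure ρ μ π).real (stopsAfterOtherBy a n)
      + (banditMeasure ρ μ π).real (stopsAfterOtherBy b n) := by
  set D : ℕ → Set (ℕ → Step k) := fun n =>
    {ω | ∃ s < n, Running (s + 1) ω ∧ (ω (s + 1)).1 = Fin.last k}
  have hmono : Monotone D := fun _ _ hmn _ ⟨s, hs, h⟩ => ⟨s, hs.trans_le hmn, h⟩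
  have hsub : correctEvent μ ε ⊆ ⋃ n, D n := by
    rintro ω ⟨s, hs, -⟩
    exact Set.mem_iUnion.2 ⟨s + 1, s, s.lt_succ_self, stopTime_eq_iff.1 hs⟩
  have hlim : Filter.Tendsto (fun n => (banditMeasure ρ μ π).real (D n)) Filter.atTop
      (nhds ((banditMeasure ρ μ π).real (⋃ n, D n))) :=
    (ENNReal.tendsto_toReal (measure_ne_top _ _)).comp (tendsto_measure_iUnion_atTop hmono)
  have hgt : 1 / 2 < (banditMeasure ρ μ π).real (⋃ n, D n) := by
    have h1 := hπ μ
    have h2 : (banditMeasure ρ μ π).real (correctEvent μ ε)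
        ≤ (banditMeasure ρ μ π).real (⋃ n, D n) := measureReal_mono hsub
    linarith
  obtain ⟨n, hn⟩ := (hlim.eventually_const_lt hgt).exists
  refine ⟨n, fun a b hab => hn.le.trans ((measureReal_mono ?_).trans (measureReal_union_le _ _))⟩
  rintro ω ⟨s, hs, hrun, hlast⟩
  by_cases ha : (ω s).1 = a
  · exact Or.inr ⟨s, hs, hrun, hlast, fun hb => hab (ha.symm.trans hb)⟩
  · exact Or.inl ⟨s, hs, hrun, hlast, ha⟩

/-- The information inequality between `uniformMeans` and the instance with arm `j` raised by ε, for
an event of probability at least 1/4 under the former and at most δ under the latter. Clearing the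
factor 1/4 produces the constants 4 and 16. -/
lemma le_integral_pullCount (hε : 0 < ε) (hε' : ε < 1 / 8) (hδ : 0 < δ) (hδ' : δ < 1)
    (hπ : IsCorrect ρ ε δ π) (j : Fin k) {n : ℕ}
    (hn : 1 / 4 ≤ (banditMeasure ρ (uniformMeans k) π).real (stopsAfterOtherBy j.castSucc n)) :
    -Real.log δ - 4 ≤ 16 * ρ * ε ^ 2 *
      ∫ ω, pullCount j.castSucc (n + 1) ω ∂banditMeasure ρ (uniformMeans k) π := by
  set m : unitInterval := ⟨1 / 2 + ε, by linarith, by linarith⟩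
  set m₀ : unitInterval := ⟨1 / 2, by norm_num, by norm_num⟩
  have hm₀ : armMean (uniformMeans k) j.castSucc = m₀ := armMean_castSucc _ _
  have hr : ∀ s, 0 < signalRatio ε s := by
    rintro (_ | _ | _) <;> simp only [signalRatio] <;> linarith
  have hR : ∀ p x, (stepMeasure ρ (Function.update (uniformMeans k) j m) p).real {x}
      = (stepMeasure ρ (uniformMeans k) p).real {x}
        * stepRatio j.castSucc (signalRatio ε) x := by
    intro p x
    rw [stepMeasure_real_singleton, stepMeasure_real_singleton, stepRatio]
    split_ifs with hx
    · rw [hx, hm₀, armMean_castSucc, Function.update_self,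
        signalMeasure_real_eq_mul_signalRatio ρ (m₀ := m₀) (m := m) (ε := ε) rfl rfl, mul_assoc]
    · rw [armMean_update_of_ne _ _ _ hx, mul_one]
  have hsum : ∑ s, (signalMeasure ρ (armMean (uniformMeans k) j.castSucc)).real {s}
      * signalRatio ε s = 1 := by
    rw [hm₀, sum_signalMeasure_real_mul]
    simp only [signalRatio, m₀]
    ring
  have hone : ∑ s, (signalMeasure ρ (armMean (uniformMeans k) j.castSucc)).real {s} = 1 := by
    have := sum_signalMeasure_real_mul ρ (armMean (uniformMeans k) j.castSucc) fun _ => 1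
    simp only [mul_one] at this
    rw [this]
    ring
  have hlog := le_sum_signalMeasure_real_mul_log ρ hε hε' (m₀ := m₀) rfl
  -- With this exponent, `e^l = 1/δ` cancels the error probability and the right-hand side is at
  -- most 1.
  have hmain := mul_measureReal_stopsAfterOtherBy_le π hr hR hsum hone (-Real.log δ) n
  have hcorrect := measureReal_stopsAfterOtherBy_le hπ j (m := m) rfl n
  rw [Real.exp_neg, Real.exp_log hδ] at hmain
  have hnonneg : 0 ≤ ∫ ω, pullCount j.castSucc (n + 1) ω ∂banditMeasure ρ (uniformMeans k) π :=
    integral_nonneg fun ω => Finset.sum_nonneg fun i _ => by split_ifs <;> simp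
  have hle : δ⁻¹ * (banditMeasure ρ (Function.update (uniformMeans k) j m) π).real
      (stopsAfterOtherBy j.castSucc n) ≤ 1 := by
    rw [inv_mul_le_iff₀ hδ]
    linarith
  have h1 := mul_le_mul_of_nonneg_left hn (neg_nonneg.2 (Real.log_nonpos hδ.le hδ'.le))
  have h2 := mul_le_mul_of_nonneg_right hlog hnonneg
  rw [hm₀] at hmain
  linarith

/-- Two distinct indices cannot both have value below 1/4, so at least `k - 1 ≥ k / 2` indices
qualify. -/
lemma half_le_card (hk : 2 ≤ k) (f : Fin k → ℝ) (hf : ∀ i j, i ≠ j → 1 / 2 ≤ f i + f j) :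
    (k : ℝ) / 2 ≤ ((Finset.univ.filter fun j => 1 / 4 ≤ f j).card : ℝ) := by
  have hcard := Finset.card_filter_add_card_filter_not (s := (Finset.univ : Finset (Fin k)))
    (fun j => 1 / 4 ≤ f j)
  have hle : (Finset.univ.filter fun j => ¬ 1 / 4 ≤ f j).card ≤ 1 := by
    refine Finset.card_le_one.2 fun i hi j hj => by_contra fun hij => ?_
    have h1 := (Finset.mem_filter.1 hi).2
    have h2 := (Finset.mem_filter.1 hj).2
    linarith [hf i j hij]
  rw [Finset.card_univ, Fintype.card_fin] at hcard
  have : k ≤ 2 * (Finset.univ.filter fun j => 1 / 4 ≤ f j).card := by omega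
  have : (k : ℝ) ≤ 2 * ((Finset.univ.filter fun j => 1 / 4 ≤ f j).card : ℝ) := by
    exact_mod_cast this
  linarith

end LowerBound

end MonitoredBandit

open MonitoredBandit in
theorem mainTheorem2 :
    ∃ c₁ c₂ : ℝ, 0 < c₁ ∧ 0 < c₂ ∧
      ∀ (k : ℕ), 2 ≤ k →
      ∀ (ε δ : ℝ), 0 < ε → ε < 1 / 8 → 0 < δ → δ < Real.exp (-4) / 4 →
      ∀ (ρ : unitInterval), 0 < ρ → ρ < 1 →
      ∀ (π : MonitoredBandit.Policy k),
        MonitoredBandit.Terminates ρ π → MonitoredBandit.IsCorrect ρ ε δ π →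
        ∃ μ : Fin k → unitInterval,
          MonitoredBandit.expectedPulls ρ μ π ≥
            ENNReal.ofReal (c₁ * (k / ((ρ : ℝ) * ε ^ 2)) * Real.log (c₂ / δ)) := by
  -- 1/32 is the product of 1/2, from the k/2 arms, and 1/16, from the bound for each arm; `exp
  -- (-4)` absorbs the subtracted 4 into the logarithm.
  refine ⟨1 / 32, Real.exp (-4), by norm_num, Real.exp_pos _, ?_⟩
  intro k hk ε δ hε hε' hδ hδ' ρ hρ _ π _ hπ
  have hexp : Real.exp (-4) ≤ 1 := Real.exp_le_one_iff.2 (by norm_num)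
  have hρ' : (0 : ℝ) < ρ := hρ
  obtain ⟨n, hn⟩ := exists_half_le_add (by linarith) hπ (uniformMeans k)
  refine ⟨uniformMeans k, ?_⟩
  have hlog : Real.log (Real.exp (-4) / δ) = -Real.log δ - 4 := by
    rw [Real.log_div (Real.exp_pos _).ne' hδ.ne', Real.log_exp]
    ring
  -- The sign is needed to replace the number of arms in `J` by its lower bound k/2.
  have hlog_nonneg : 0 ≤ -Real.log δ - 4 := by
    rw [← hlog]
    refine Real.log_nonneg ((one_le_div hδ).2 ?_)
    linarith [Real.exp_pos (-4)]
  set f : Fin k → ℝ := fun j =>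
    (banditMeasure ρ (uniformMeans k) π).real (stopsAfterOtherBy j.castSucc n)
  have hcard := half_le_card hk f fun i j hij =>
    hn _ _ fun h => hij (Fin.castSucc_injective k h)
  set J := Finset.univ.filter fun j => 1 / 4 ≤ f j
  have hC : 0 < 16 * (ρ : ℝ) * ε ^ 2 := by positivity
  have hj : ∀ j ∈ J, (-Real.log δ - 4) / (16 * ρ * ε ^ 2) ≤
      ∫ ω, pullCount j.castSucc (n + 1) ω ∂banditMeasure ρ (uniformMeans k) π := fun j hj =>
    (div_le_iff₀' hC).2
      (le_integral_pullCount hε hε' hδ (by linarith) hπ j (Finset.mem_filter.1 hj).2)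
  refine le_trans (ENNReal.ofReal_le_ofReal ?_)
    (ofReal_sum_integral_pullCount_le ρ (uniformMeans k) π J (n + 1))
  have hsum := Finset.card_nsmul_le_sum J _ _ hj
  rw [nsmul_eq_mul] at hsum
  refine le_trans ?_ hsum
  rw [hlog]
  calc _ = (k : ℝ) / 2 * ((-Real.log δ - 4) / (16 * ρ * ε ^ 2)) := by field_simp; ring
    _ ≤ _ := mul_le_mul_of_nonneg_right hcard (div_nonneg hlog_nonneg hC.le)
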